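/- Let $k\in\mathbb N=\{0,1,2,\dots\}$, let $[\![k,\infty)=\{l\in\mathbb N: l\ge k\}$, and let $\mathcal P([\![k,\infty))$ be the semigroup of all finite nonempty subsets of $[\![k,\infty)$ under setwise addition $X+Y=\{x+y: x\in X,\ y\in Y\}$. For $X\in\mathcal P([\![k,\infty))$ let $\alpha(X)$ and $\beta(X)$ denote the minimum and the maximum of $X$. Then the map $$\sigma: X\mapsto \beta(X)-X+\alpha(X)=\{\beta(X)-x+\alpha(X): x\in X\}$$ is an automorphism of $\mathcal P([\![k,\infty))$, it is an involution ($\sigma\circ\sigma=\mathrm{id}$) different from the identity, and every automorphism of $\mathcal P([\![k,\infty))$ is either the identity or $\sigma$. -/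

import Mathlib

open scoped Pointwise

/-- The finitary power semigroup `P(S)` of a subsemigroup `S` of `(ℕ, +)`:
the finite nonempty subsets of `S`. -/
def PowerSemigroup (S : AddSubsemigroup ℕ) : Type :=
  {X : Finset ℕ // X.Nonempty ∧ ∀ x ∈ X, x ∈ S}

namespace PowerSemigroup

/-- Setwise addition `X + Y = {x + y : x ∈ X, y ∈ Y}` makes `P(S)` a commutative semigroup. -/
instance (S : AddSubsemigroup ℕ) : AddCommSemigroup (PowerSemigroup S) where
  add X Y := ⟨X.1 + Y.1, X.2.1.add Y.2.1, by
    intro z hz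
    obtain ⟨x, hx, y, hy, rfl⟩ := Finset.mem_add.mp hz
    exact S.add_mem (X.2.2 x hx) (Y.2.2 y hy)⟩
  add_assoc X Y Z := Subtype.ext (add_assoc X.1 Y.1 Z.1)
  add_comm X Y := Subtype.ext (add_comm X.1 Y.1)

/-- `α(X)`, the minimum member of `X`. -/
def α {S : AddSubsemigroup ℕ} (X : PowerSemigroup S) : ℕ := X.1.min' X.2.1

/-- `β(X)`, the maximum member of `X`. -/
def β {S : AddSubsemigroup ℕ} (X : PowerSemigroup S) : ℕ := X.1.max' X.2.1

end PowerSemigroup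

/-- The discrete interval `[k, ∞) = {l ∈ ℕ : l ≥ k}` as a subsemigroup of `(ℕ, +)`. -/
def discreteInterval (k : ℕ) : AddSubsemigroup ℕ where
  carrier := Set.Ici k
  add_mem' {a b} ha _ := le_trans (Set.mem_Ici.mp ha) (Nat.le_add_right a b)

/-- The map `σ : X ↦ β(X) - X + α(X) = {β(X) - x + α(X) : x ∈ X}` of `P([k, ∞))` into itself.
Since `x ≤ β(X)` for `x ∈ X`, the subtraction in `ℕ` is never truncated. -/
def reversal (k : ℕ) (X : PowerSemigroup (discreteInterval k)) :
    PowerSemigroup (discreteInterval k) :=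
  ⟨X.1.image (fun x => X.β - x + X.α), X.2.1.image _, by
    intro z hz
    obtain ⟨x, _, rfl⟩ := Finset.mem_image.mp hz
    have h : k ≤ X.α := X.2.2 _ (X.1.min'_mem X.2.1)
    exact le_trans h (Nat.le_add_left _ _)⟩

/-! Cancellative elements are the singletons, so an automorphism permutes them additively, and
coprimality of `k` and `k + 1` makes that permutation trivial. It therefore commutes with
translations, preserves minima, and induces an automorphism `f` of the monoid of finite sets
containing `0`, where reversal becomes `A ↦ max A - A`.

There `f` fixes `{0, 1}`, hence all intervals `{0, …, n}`, and preserves maxima. Whether `i + 1 ∈ A`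
can be read off from sums of `A` with two punctured intervals `{0} ∪ {j + 1, …, M}`
(`succ_mem_iff`), so it suffices that `f` fixes enough of these. The set `{0, 2, 3}` goes to itself
or to its mirror image `{0, 1, 3}`; after composing with the reflection it is fixed. Then `f`
preserves membership of `1` and of `max A - 1`. A gap argument gives `f P ⊆ P` for a punctured
interval `P`, and comparing `P + f P` with `P + P` gives `f (P + P) = P + P`. -/

/-- The reduced finitary power monoid of `ℕ`: the finite subsets of `ℕ` containing `0`. -/
def reducedPower : AddSubmonoid (Finset ℕ) where
  carrier := {X | 0 ∈ X}
  zero_mem' := by simp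
  add_mem' ha hb := by simpa using Finset.add_mem_add ha hb

namespace reducedPower

lemma mem_add {A B : reducedPower} {z : ℕ} :
    z ∈ (A + B).1 ↔ ∃ x ∈ A.1, ∃ y ∈ B.1, x + y = z := Finset.mem_add

lemma zero_mem' (A : reducedPower) : 0 ∈ A.1 := A.2

lemma ext' {A B : reducedPower} (h : ∀ x, x ∈ A.1 ↔ x ∈ B.1) : A = B :=
  Subtype.ext (Finset.ext h)

/-! ### Maxima and multiples of sets containing `0`. -/

/-- The maximum of a finite set of natural numbers containing `0`. -/
def top (A : reducedPower) : ℕ := A.1.max' ⟨0, A.2⟩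

lemma top_mem (A : reducedPower) : top A ∈ A.1 := Finset.max'_mem _ _

lemma le_top {A : reducedPower} {x : ℕ} (h : x ∈ A.1) : x ≤ top A := Finset.le_max' _ _ h

lemma top_eq {A : reducedPower} {n : ℕ} (h : n ∈ A.1) (h' : ∀ x ∈ A.1, x ≤ n) : top A = n :=
  le_antisymm (h' _ (top_mem A)) (le_top h)

lemma top_add (A B : reducedPower) : top (A + B) = top A + top B := by
  refine top_eq (mem_add.2 ⟨_, top_mem A, _, top_mem B, rfl⟩) fun x hx => ?_
  obtain ⟨a, ha, b, hb, rfl⟩ := mem_add.1 hx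
  exact add_le_add (le_top ha) (le_top hb)

lemma top_zero : top (0 : reducedPower) = 0 :=
  top_eq (zero_mem' _) fun x hx => by
    have : x ∈ (0 : Finset ℕ) := hx
    simpa using this

lemma top_nsmul (n : ℕ) (A : reducedPower) : top (n • A) = n * top A := by
  induction n with
  | zero => simp [top_zero]
  | succ n ih => rw [succ_nsmul, top_add, ih]; ring

lemma mul_mem_nsmul {A : reducedPower} {x : ℕ} (h : x ∈ A.1) (n : ℕ) : n * x ∈ (n • A).1 := by
  induction n with
  | zero => simp
  | succ n ih =>
    rw [succ_nsmul]
    exact mem_add.2 ⟨_, ih, _, h, by ring⟩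

lemma add_mem_nsmul {A : reducedPower} {x y m n : ℕ} (hx : x ∈ (m • A).1) (hy : y ∈ (n • A).1) :
    x + y ∈ ((m + n) • A).1 := by
  rw [add_nsmul]
  exact mem_add.2 ⟨_, hx, _, hy, rfl⟩

lemma mem_nsmul_of_le {A : reducedPower} {x m n : ℕ} (h : m ≤ n) (hx : x ∈ (m • A).1) :
    x ∈ (n • A).1 := by
  obtain ⟨d, rfl⟩ := Nat.exists_eq_add_of_le h
  simpa using add_mem_nsmul hx (zero_mem' (d • A))

/-! ### Intervals with an initial gap. -/

/-- The set `{0} ∪ {j + 1, …, M}`. -/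
def punctured (j M : ℕ) : reducedPower :=
  ⟨(Finset.range (M + 1)).filter fun x => x = 0 ∨ j < x,
    Finset.mem_filter.2 ⟨Finset.mem_range.2 (Nat.succ_pos M), Or.inl rfl⟩⟩

lemma mem_punctured {j M x : ℕ} : x ∈ (punctured j M).1 ↔ x ≤ M ∧ (x = 0 ∨ j < x) := by
  simp [punctured]

/-- The interval `{0, …, n}`. -/
abbrev initial (n : ℕ) : reducedPower := punctured 0 n

lemma mem_initial {n x : ℕ} : x ∈ (initial n).1 ↔ x ≤ n := by
  rw [mem_punctured]; omega

lemma top_punctured {j M : ℕ} (h : j < M) : top (punctured j M) = M :=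
  top_eq (mem_punctured.2 (by omega)) fun _ hx => (mem_punctured.1 hx).1

lemma top_initial (n : ℕ) : top (initial n) = n :=
  top_eq (mem_initial.2 le_rfl) fun _ hx => mem_initial.1 hx

lemma punctured_add {j M N : ℕ} (hM : 2 * j + 1 ≤ M) (hN : j + 1 ≤ N) :
    punctured j M + punctured j N = punctured j (M + N) := by
  refine ext' fun c => ?_
  rw [mem_add, mem_punctured]
  constructor
  · rintro ⟨x, hx, y, hy, rfl⟩
    rw [mem_punctured] at hx hy
    omega
  · rintro ⟨h1, h2⟩
    by_cases h3 : c ≤ M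
    · exact ⟨c, mem_punctured.2 (by omega), 0, zero_mem' _, rfl⟩
    by_cases h4 : M + j < c
    · exact ⟨M, mem_punctured.2 (by omega), c - M, mem_punctured.2 (by omega), by omega⟩
    -- Here `c ≥ M + 1 ≥ 2 * j + 2`, so `c - (j + 1)` still exceeds `j`.
    · exact ⟨c - (j + 1), mem_punctured.2 (by omega), j + 1, mem_punctured.2 (by omega), by omega⟩

lemma nsmul_punctured {j M : ℕ} (hM : 2 * j + 1 ≤ M) (n : ℕ) :
    (n + 1) • punctured j M = punctured j ((n + 1) * M) := by
  induction n with
  | zero => simp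
  | succ n ih =>
    rw [succ_nsmul, ih, add_comm, punctured_add hM]
    · congr 1; ring
    · nlinarith

lemma nsmul_initial_one (n : ℕ) : n • initial 1 = initial n := by
  cases n with
  | zero =>
    refine ext' fun x => ?_
    rw [mem_initial, zero_nsmul]
    exact Finset.mem_zero.trans (by omega)
  | succ n => simpa using nsmul_punctured (j := 0) (M := 1) (by omega) n

lemma add_initial {A : reducedPower} {n : ℕ} (h : top A ≤ n) :
    A + initial n = initial (n + top A) := by
  refine ext' fun c => ?_
  rw [mem_add, mem_initial]
  constructor
  · rintro ⟨x, hx, y, hy, rfl⟩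
    rw [mem_initial] at hy
    have := le_top hx
    omega
  · intro hc
    by_cases h3 : c ≤ n
    · exact ⟨0, zero_mem' _, c, mem_initial.2 h3, by omega⟩
    · exact ⟨_, top_mem _, c - top A, mem_initial.2 (by omega), by omega⟩

/-- The two punctured sets differ only in `i + 1`. A sum `x + (i + 1)` with `x > 0` is also `0 + (x
+ i + 1)`, as `M` is large, so only the element `i + 1` is in doubt, and without that summand it can
only arise as `(i + 1) + 0`. -/
lemma succ_mem_iff {A : reducedPower} {i M : ℕ} (h : top A + i + 1 ≤ M) :
    i + 1 ∈ A.1 ↔ A + punctured (i + 1) M = A + punctured i M := by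
  constructor
  · intro hi
    refine ext' fun c => ?_
    simp only [mem_add]
    constructor
    · rintro ⟨x, hx, y, hy, rfl⟩
      rw [mem_punctured] at hy
      exact ⟨x, hx, y, mem_punctured.2 (by omega), rfl⟩
    · rintro ⟨x, hx, y, hy, rfl⟩
      rw [mem_punctured] at hy
      have := le_top hx
      by_cases hy1 : y = i + 1
      · by_cases hx0 : x = 0
        · exact ⟨i + 1, hi, 0, zero_mem' _, by omega⟩
        · exact ⟨0, zero_mem' _, x + y, mem_punctured.2 (by omega), by omega⟩
      · exact ⟨x, hx, y, mem_punctured.2 (by omega), rfl⟩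
  · intro he
    have hm : i + 1 ∈ (A + punctured i M).1 :=
      mem_add.2 ⟨0, zero_mem' _, i + 1, mem_punctured.2 (by omega), by omega⟩
    rw [← he, mem_add] at hm
    obtain ⟨x, hx, y, hy, hxy⟩ := hm
    rw [mem_punctured] at hy
    have : x = i + 1 := by omega
    exact this ▸ hx

/-- If a set contains `0 < i` and the two numbers `M - 1` and `M`, where `M` is its maximum,
then a large multiple of it has no gaps longer than `i`. -/
lemma nsmul_add_initial {A : reducedPower} {i M : ℕ} (hM : top A = M) (hM1 : M - 1 ∈ A.1)
    (hi : i ∈ A.1) (hi0 : 0 < i) :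
    (M * M) • A + initial (i - 1) = initial (M * M * M + (i - 1)) := by
  have hM0 : 0 < M := by have := le_top hi; omega
  refine ext' fun c => ?_
  rw [mem_add, mem_initial]
  constructor
  · rintro ⟨x, hx, y, hy, rfl⟩
    rw [mem_initial] at hy
    have := le_top hx
    rw [top_nsmul, hM] at this
    omega
  · intro hc
    have hMA : M ∈ A.1 := hM ▸ top_mem A
    by_cases h1 : M * M * M ≤ c
    · exact ⟨M * M * M, mul_mem_nsmul hMA _, c - M * M * M, mem_initial.2 (by omega), by omega⟩
    push Not at h1
    by_cases h2 : M * M * M ≤ c + M * M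
    · refine ⟨c, ?_, 0, zero_mem' _, rfl⟩
      obtain ⟨d, hd⟩ := Nat.exists_eq_add_of_lt h1
      have hdM : d + 1 ≤ M * M := by omega
      -- Near the top, `c = M ^ 3 - (d + 1)`: replace `d + 1` of the `M ^ 2` summands `M` by `M -
      -- 1`.
      have h3 := add_mem_nsmul (mul_mem_nsmul hM1 (d + 1)) (mul_mem_nsmul hMA (M * M - (d + 1)))
      rw [Nat.add_sub_cancel' hdM] at h3
      convert h3 using 1
      obtain ⟨e, he⟩ := Nat.exists_eq_add_of_le hdM
      obtain ⟨m, rfl⟩ := Nat.exists_eq_succ_of_ne_zero hM0.ne'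
      simp only [Nat.succ_eq_add_one, Nat.add_sub_cancel] at *
      rw [he, Nat.add_sub_cancel_left]
      rw [he] at hd
      nlinarith
    -- Lower down, divide `c` by `M` and the remainder by `i`. The bound on `c` leaves room for
    -- fewer than `M` extra summands `i`, and the last remainder is at most `i - 1`.
    · have hq := Nat.div_add_mod c M
      have hr := Nat.mod_lt c hM0
      have hs := Nat.div_add_mod (c % M) i
      have ht := Nat.mod_lt (c % M) hi0
      have hsl : c % M / i ≤ c % M := Nat.div_le_self _ _
      have hle : c / M + c % M / i ≤ M * M := by
        by_contra! hcon
        have : M * M + 1 ≤ c / M + M := by omega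
        nlinarith
      refine ⟨c / M * M + c % M / i * i, mem_nsmul_of_le hle
        (add_mem_nsmul (mul_mem_nsmul hMA _) (mul_mem_nsmul hi _)), c % M % i,
        mem_initial.2 (by omega), ?_⟩
      rw [mul_comm (c / M), mul_comm (c % M / i)]
      omega

/-! ### The reflection. -/

/-- The involution `A ↦ max A - A`. -/
def reflect (A : reducedPower) : reducedPower :=
  ⟨A.1.image fun x => top A - x, Finset.mem_image.2 ⟨_, top_mem A, by simp⟩⟩

lemma mem_reflect {A : reducedPower} {z : ℕ} :
    z ∈ (reflect A).1 ↔ ∃ x ∈ A.1, z + x = top A := by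
  refine Finset.mem_image.trans ⟨?_, ?_⟩
  · rintro ⟨x, hx, rfl⟩
    exact ⟨x, hx, Nat.sub_add_cancel (le_top hx)⟩
  · rintro ⟨x, hx, h⟩
    exact ⟨x, hx, by omega⟩

lemma top_reflect (A : reducedPower) : top (reflect A) = top A :=
  top_eq (mem_reflect.2 ⟨0, zero_mem' _, rfl⟩) fun x hx => by
    obtain ⟨y, -, h⟩ := mem_reflect.1 hx
    omega

lemma reflect_reflect (A : reducedPower) : reflect (reflect A) = A := by
  refine ext' fun x => ?_
  rw [mem_reflect, top_reflect]
  constructor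
  · rintro ⟨y, hy, h⟩
    obtain ⟨z, hz, h'⟩ := mem_reflect.1 hy
    have : x = z := by omega
    exact this ▸ hz
  · intro hx
    have := le_top hx
    exact ⟨top A - x, mem_reflect.2 ⟨x, hx, by omega⟩, by omega⟩

/-- The map `A ↦ max A - A` as an automorphism. -/
def reflectEquiv : reducedPower ≃+ reducedPower where
  toFun := reflect
  invFun := reflect
  left_inv := reflect_reflect
  right_inv := reflect_reflect
  map_add' A B := by
    refine ext' fun z => ?_
    simp only [mem_reflect, mem_add, top_add]
    constructor
    · rintro ⟨_, ⟨x, hx, y, hy, rfl⟩, h⟩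
      have := le_top hx
      have := le_top hy
      exact ⟨top A - x, ⟨x, hx, by omega⟩, top B - y, ⟨y, hy, by omega⟩, by omega⟩
    · rintro ⟨x, ⟨a, ha, h⟩, y, ⟨b, hb, h'⟩, rfl⟩
      exact ⟨a + b, ⟨a, ha, b, hb, rfl⟩, by omega⟩

lemma reflectEquiv_apply (A : reducedPower) : reflectEquiv A = reflect A := rfl

/-! ### Automorphisms of the reduced monoid. -/

section Automorphisms

variable (f : reducedPower ≃+ reducedPower)

/-- With `I = {0, 1}` and `n = max X`, both `X + n • I` and `2n • I` equal `{0, …, 2n}`. Applying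
`f` with `X = f⁻¹ I` and taking maxima yields `max X * max (f I) = 1`. -/
lemma map_initial_one : f (initial 1) = initial 1 := by
  have key : ∀ X : reducedPower,
      f X + top X • f (initial 1) = (top X + top X) • f (initial 1) := fun X => by
    rw [← map_nsmul, ← map_nsmul, ← map_add, nsmul_initial_one, nsmul_initial_one,
      add_initial le_rfl]
  have h := congrArg top (key (f.symm (initial 1)))
  rw [f.apply_symm_apply, top_add, top_nsmul, top_nsmul, top_initial] at h
  have h1 : top (f.symm (initial 1)) * top (f (initial 1)) = 1 := by
    rw [add_mul] at h; omega
  have h2 : top (f (initial 1)) = 1 := Nat.eq_one_of_mul_eq_one_left h1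
  refine ext' fun x => ?_
  rw [mem_initial]
  constructor
  · intro hx; have := le_top hx; omega
  · intro hx
    interval_cases x
    · exact zero_mem' _
    · have := top_mem (f (initial 1)); rwa [h2] at this

lemma map_initial (n : ℕ) : f (initial n) = initial n := by
  rw [← nsmul_initial_one, map_nsmul, map_initial_one]

lemma top_map (A : reducedPower) : top (f A) = top A := by
  have h := congrArg top (congrArg f (add_initial (A := A) le_rfl))
  rw [map_add, map_initial, map_initial, top_add, top_initial, top_initial] at h
  omega

variable {f}

lemma symm_fixes {A : reducedPower} (h : f A = A) : f.symm A = A := by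
  rw [f.symm_apply_eq, h]

lemma succ_mem_map_iff {A : reducedPower} {i M : ℕ} (hM : top A + i + 1 ≤ M)
    (h1 : f (punctured (i + 1) M) = punctured (i + 1) M)
    (h2 : f (punctured i M) = punctured i M) : i + 1 ∈ (f A).1 ↔ i + 1 ∈ A.1 := by
  rw [succ_mem_iff hM, succ_mem_iff ((top_map f A).symm ▸ hM)]
  conv_lhs => rw [← h1, ← h2, ← map_add, ← map_add]
  exact f.injective.eq_iff

/-- Multiples of `{0, 2, 3}` are punctured at `1` with arbitrarily large maximum, so they are fixed
and detect the element `1`. -/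
lemma one_mem_map_iff (hf : f (punctured 1 3) = punctured 1 3) (A : reducedPower) :
    1 ∈ (f A).1 ↔ 1 ∈ A.1 := by
  refine succ_mem_map_iff (i := 0) (M := (top A + 1) * 3) (by omega) ?_ (map_initial _ _)
  have := nsmul_punctured (j := 1) (M := 3) (by norm_num) (top A)
  rw [zero_add, ← this, map_nsmul, hf]

/-- The image has maximum `3`. It is not `{0, 1, 2, 3}`, which is already the image of itself, and
`{0, 2, 3} + {0, 1} = {0, …, 4}` rules out `{0, 3}`. -/
lemma map_punctured_one_three (f : reducedPower ≃+ reducedPower) :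
    f (punctured 1 3) = punctured 1 3 ∨ f (punctured 1 3) = reflect (punctured 1 3) := by
  have ht : top (punctured 1 3) = 3 := top_punctured (by norm_num)
  have hr : ∀ x, x ∈ (reflect (punctured 1 3)).1 ↔ x = 0 ∨ x = 1 ∨ x = 3 := fun x => by
    rw [mem_reflect, ht]
    constructor
    · rintro ⟨y, hy, h⟩
      rw [mem_punctured] at hy
      omega
    · intro h
      exact ⟨3 - x, mem_punctured.2 (by omega), by omega⟩
  have ht' := top_map f (punctured 1 3)
  rw [ht] at ht'
  have h3 : 3 ∈ (f (punctured 1 3)).1 := by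
    have := top_mem (f (punctured 1 3))
    rwa [ht'] at this
  have h0 := zero_mem' (f (punctured 1 3))
  have hle : ∀ x ∈ (f (punctured 1 3)).1, x ≤ 3 := fun x hx => ht' ▸ le_top hx
  by_cases h1 : 1 ∈ (f (punctured 1 3)).1
  · by_cases h2 : 2 ∈ (f (punctured 1 3)).1
    · have h : f (punctured 1 3) = initial 3 := by
        refine ext' fun x => ?_
        rw [mem_initial]
        refine ⟨hle x, fun hx => ?_⟩
        interval_cases x <;> assumption
      rw [← map_initial f 3, f.injective.eq_iff] at h
      have h1' : 1 ∈ (punctured 1 3).1 := h ▸ mem_initial.2 (by norm_num)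
      rw [mem_punctured] at h1'
      omega
    · right
      refine ext' fun x => ?_
      rw [hr]
      constructor
      · intro hx
        have := hle x hx
        have : x ≠ 2 := fun h => h2 (h ▸ hx)
        omega
      · rintro (rfl | rfl | rfl) <;> assumption
  · have hfull : f (punctured 1 3) + initial 1 = initial 4 := by
      have : punctured 1 3 + initial 1 = initial 4 := by
        refine ext' fun x => ?_
        rw [mem_add, mem_initial]
        constructor
        · rintro ⟨y, hy, z, hz, rfl⟩
          rw [mem_punctured] at hy
          rw [mem_initial] at hz
          omega
        · intro hx
          by_cases h : x ≤ 1
          · exact ⟨0, zero_mem' _, x, mem_initial.2 h, by omega⟩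
          · exact ⟨if x = 2 then 2 else x - 1, mem_punctured.2 (by split_ifs <;> omega),
              if x = 2 then 0 else 1, mem_initial.2 (by split_ifs <;> omega),
              by split_ifs <;> omega⟩
      conv_lhs => rw [← map_initial f 1, ← map_add, this]
      exact map_initial f 4
    have h2 : 2 ∈ (f (punctured 1 3) + initial 1).1 := hfull ▸ mem_initial.2 (by norm_num)
    obtain ⟨y, hy, z, hz, h⟩ := mem_add.1 h2
    rw [mem_initial] at hz
    have hy1 : y ≠ 1 := fun h => h1 (h ▸ hy)
    have hy2 : y = 2 := by omega
    subst hy2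
    left
    refine ext' fun x => ?_
    rw [mem_punctured]
    constructor
    · intro hx
      have := hle x hx
      have : x ≠ 1 := fun h => h1 (h ▸ hx)
      omega
    · rintro ⟨hx, hx'⟩
      interval_cases x
      · assumption
      · omega
      · assumption
      · assumption

lemma map_reflect_punctured (hf : f (punctured 1 3) = punctured 1 3) :
    f (reflect (punctured 1 3)) = reflect (punctured 1 3) := by
  have h := map_punctured_one_three ((reflectEquiv.trans f).trans reflectEquiv)
  simp only [AddEquiv.trans_apply, reflectEquiv_apply] at h
  rcases h with h | h
  · rw [← reflect_reflect (f _), h]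
  -- Injectivity would make `{0, 2, 3}` its own mirror image; the goal follows without refuting
  -- this.
  · have h' := congrArg reflect h
    rw [reflect_reflect, reflect_reflect] at h'
    have h2 := f.injective (h'.trans hf.symm)
    rw [h2, hf]

/-- This is `one_mem_map_iff` for the conjugate of `f` by the reflection. -/
lemma pred_top_mem_map (hf : f (punctured 1 3) = punctured 1 3) {A : reducedPower}
    (h0 : 0 < top A) (h : top A - 1 ∈ A.1) : top A - 1 ∈ (f A).1 := by
  have hg : ((reflectEquiv.trans f).trans reflectEquiv) (punctured 1 3) = punctured 1 3 := by
    simp only [AddEquiv.trans_apply, reflectEquiv_apply]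
    rw [map_reflect_punctured hf, reflect_reflect]
  have h1 := one_mem_map_iff hg (reflect A)
  simp only [AddEquiv.trans_apply, reflectEquiv_apply, reflect_reflect] at h1
  obtain ⟨x, hx, hx'⟩ := mem_reflect.1 (h1.2 (mem_reflect.2 ⟨_, h, by omega⟩))
  rw [top_map] at hx'
  have : x = top A - 1 := by omega
  exact this ▸ hx

/-- If the image contained some `0 < i ≤ j`, a large multiple of it plus `{0, …, i - 1}` would be an
interval. Pulling back, a multiple of the punctured set plus `{0, …, i - 1}` would be one too, yet
it misses `j`. -/
lemma map_punctured_subset (hf : f (punctured 1 3) = punctured 1 3) {j M : ℕ}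
    (hM : 2 * j + 1 ≤ M) : (f (punctured j M)).1 ⊆ (punctured j M).1 := by
  intro i hi
  have htop : top (punctured j M) = M := top_punctured (by omega)
  have htop' : top (f (punctured j M)) = M := (top_map f _).trans htop
  rw [mem_punctured]
  refine ⟨htop' ▸ le_top hi, ?_⟩
  by_contra! hcon
  have hM1 : M - 1 ∈ (f (punctured j M)).1 := by
    have := pred_top_mem_map hf (A := punctured j M) (by omega)
      (mem_punctured.2 (by omega))
    rwa [htop] at this
  have h := nsmul_add_initial htop' hM1 hi (by omega)
  rw [← map_nsmul, ← map_initial f (i - 1), ← map_add, ← map_initial f (M * M * M + (i - 1)),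
    f.injective.eq_iff] at h
  obtain ⟨n, hn⟩ := Nat.exists_eq_succ_of_ne_zero
    (Nat.mul_pos (show 0 < M by omega) (show 0 < M by omega)).ne'
  rw [hn, nsmul_punctured hM] at h
  have hj : j ∈ (initial (n.succ * M + (i - 1))).1 := mem_initial.2 (by nlinarith)
  rw [← h, mem_add] at hj
  obtain ⟨x, hx, y, hy, hxy⟩ := hj
  rw [mem_punctured] at hx
  rw [mem_initial] at hy
  omega

lemma punctured_add_map (hf : f (punctured 1 3) = punctured 1 3) {j M : ℕ}
    (hM : 3 * j + 1 ≤ M) :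
    punctured j M + f (punctured j M) = punctured j M + punctured j M := by
  have hsub := map_punctured_subset hf (j := j) (M := M) (by omega)
  have hfull : f (punctured j M) + initial j = initial (M + j) := by
    have : punctured j M + initial j = initial (M + j) := by
      refine ext' fun x => ?_
      rw [mem_add, mem_initial]
      constructor
      · rintro ⟨y, hy, z, hz, rfl⟩
        rw [mem_punctured] at hy
        rw [mem_initial] at hz
        omega
      · intro hx
        by_cases h : x ≤ j
        · exact ⟨0, zero_mem' _, x, mem_initial.2 h, by omega⟩
        by_cases h' : x ≤ M
        · exact ⟨x, mem_punctured.2 (by omega), 0, zero_mem' _, by omega⟩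
        · exact ⟨M, mem_punctured.2 (by omega), x - M, mem_initial.2 (by omega), by omega⟩
    conv_lhs => rw [← map_initial f j, ← map_add, this]
    exact map_initial f _
  -- This produces `w` in the image with `j + 1 ≤ w ≤ 2 * j + 1`. For `M < c ≤ M + j`, the
  -- hypothesis `3 * j + 1 ≤ M` then puts `c - w` strictly between `j` and `M`.
  have hw : 2 * j + 1 ∈ (f (punctured j M) + initial j).1 := hfull ▸ mem_initial.2 (by omega)
  obtain ⟨w, hw, s, hs, hws⟩ := mem_add.1 hw
  rw [mem_initial] at hs
  have hMW : M ∈ (f (punctured j M)).1 := by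
    have := top_mem (f (punctured j M))
    rwa [top_map, top_punctured (by omega)] at this
  rw [punctured_add (by omega) (by omega)]
  refine ext' fun c => ?_
  rw [mem_add, mem_punctured]
  constructor
  · rintro ⟨x, hx, y, hy, rfl⟩
    have hy := hsub hy
    rw [mem_punctured] at hx hy
    omega
  · rintro ⟨h1, h2⟩
    by_cases h3 : c ≤ M
    · exact ⟨c, mem_punctured.2 (by omega), 0, zero_mem' _, rfl⟩
    by_cases h4 : M + j < c
    · exact ⟨c - M, mem_punctured.2 (by omega), M, hMW, by omega⟩
    · exact ⟨c - w, mem_punctured.2 (by omega), w, hw, by omega⟩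

/-- Write `P` for the punctured set. The previous lemma for `f` gives `P + f P = P + P`; for
`f.symm`, after applying `f`, it gives `f P + P = f P + f P`. -/
lemma map_punctured (hf : f (punctured 1 3) = punctured 1 3) {j M : ℕ} (hM : 3 * j + 1 ≤ M) :
    f (punctured j (M + M)) = punctured j (M + M) := by
  have h1 := punctured_add_map hf hM
  have h2 := congrArg f (punctured_add_map (symm_fixes hf) hM)
  rw [map_add, map_add, f.apply_symm_apply] at h2
  rw [← punctured_add (by omega) (by omega), map_add, ← h2, add_comm, h1]

lemma map_eq_self (hf : f (punctured 1 3) = punctured 1 3) (A : reducedPower) : f A = A := by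
  refine ext' fun x => ?_
  cases x with
  | zero => exact iff_of_true (zero_mem' _) (zero_mem' _)
  | succ i =>
    -- Half of this `M` is at least `3 * (i + 1) + 1`, as needed for both gaps `i` and `i + 1`.
    exact succ_mem_map_iff (M := (top A + 3 * i + 4) + (top A + 3 * i + 4)) (by omega)
      (map_punctured hf (by omega)) (map_punctured hf (by omega))

variable (f) in
/-- The only automorphisms of the reduced finitary power monoid of `ℕ` are the identity and
`A ↦ max A - A`. -/
theorem automorphism_classification : (∀ A, f A = A) ∨ ∀ A, f A = reflect A := by
  rcases map_punctured_one_three f with h | h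
  · exact Or.inl (map_eq_self h)
  · right
    intro A
    have hg : (f.trans reflectEquiv) (punctured 1 3) = punctured 1 3 := by
      rw [AddEquiv.trans_apply, h, reflectEquiv_apply, reflect_reflect]
    have := map_eq_self hg A
    rw [AddEquiv.trans_apply, reflectEquiv_apply] at this
    rw [← this, reflect_reflect, this]

end Automorphisms

end reducedPower

/-! ### Minima, maxima and reversal in the power semigroup. -/

namespace PowerSemigroup

variable {k : ℕ}

lemma ext_mem {S : AddSubsemigroup ℕ} {X Y : PowerSemigroup S} (h : ∀ x, x ∈ X.1 ↔ x ∈ Y.1) :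
    X = Y := Subtype.ext (Finset.ext h)

lemma mem_add {S : AddSubsemigroup ℕ} {X Y : PowerSemigroup S} {z : ℕ} :
    z ∈ (X + Y).1 ↔ ∃ x ∈ X.1, ∃ y ∈ Y.1, x + y = z := Finset.mem_add

lemma le_of_mem {X : PowerSemigroup (discreteInterval k)} {x : ℕ} (h : x ∈ X.1) : k ≤ x :=
  X.2.2 x h

lemma α_mem {S : AddSubsemigroup ℕ} (X : PowerSemigroup S) : X.α ∈ X.1 := Finset.min'_mem _ _

lemma β_mem {S : AddSubsemigroup ℕ} (X : PowerSemigroup S) : X.β ∈ X.1 := Finset.max'_mem _ _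

lemma α_le {S : AddSubsemigroup ℕ} {X : PowerSemigroup S} {x : ℕ} (h : x ∈ X.1) : X.α ≤ x :=
  Finset.min'_le _ _ h

lemma le_β {S : AddSubsemigroup ℕ} {X : PowerSemigroup S} {x : ℕ} (h : x ∈ X.1) : x ≤ X.β :=
  Finset.le_max' _ _ h

lemma α_eq {S : AddSubsemigroup ℕ} {X : PowerSemigroup S} {n : ℕ} (h : n ∈ X.1)
    (h' : ∀ x ∈ X.1, n ≤ x) : X.α = n :=
  le_antisymm (α_le h) (h' _ X.α_mem)

lemma β_eq {S : AddSubsemigroup ℕ} {X : PowerSemigroup S} {n : ℕ} (h : n ∈ X.1)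
    (h' : ∀ x ∈ X.1, x ≤ n) : X.β = n :=
  le_antisymm (h' _ X.β_mem) (le_β h)

lemma α_add {S : AddSubsemigroup ℕ} (X Y : PowerSemigroup S) : (X + Y).α = X.α + Y.α := by
  refine α_eq (mem_add.2 ⟨_, X.α_mem, _, Y.α_mem, rfl⟩) fun x hx => ?_
  obtain ⟨a, ha, b, hb, rfl⟩ := mem_add.1 hx
  exact add_le_add (α_le ha) (α_le hb)

lemma β_add {S : AddSubsemigroup ℕ} (X Y : PowerSemigroup S) : (X + Y).β = X.β + Y.β := by
  refine β_eq (mem_add.2 ⟨_, X.β_mem, _, Y.β_mem, rfl⟩) fun x hx => ?_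
  obtain ⟨a, ha, b, hb, rfl⟩ := mem_add.1 hx
  exact add_le_add (le_β ha) (le_β hb)

lemma mem_reversal {X : PowerSemigroup (discreteInterval k)} {z : ℕ} :
    z ∈ (reversal k X).1 ↔ ∃ x ∈ X.1, z + x = X.α + X.β := by
  refine Finset.mem_image.trans ⟨?_, ?_⟩
  · rintro ⟨x, hx, rfl⟩
    have := le_β hx
    exact ⟨x, hx, by omega⟩
  · rintro ⟨x, hx, h⟩
    have := le_β hx
    exact ⟨x, hx, by omega⟩

lemma α_reversal (X : PowerSemigroup (discreteInterval k)) : (reversal k X).α = X.α :=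
  α_eq (mem_reversal.2 ⟨_, X.β_mem, rfl⟩) fun x hx => by
    obtain ⟨y, hy, h⟩ := mem_reversal.1 hx
    have := le_β hy
    omega

lemma β_reversal (X : PowerSemigroup (discreteInterval k)) : (reversal k X).β = X.β :=
  β_eq (mem_reversal.2 ⟨_, X.α_mem, add_comm _ _⟩) fun x hx => by
    obtain ⟨y, hy, h⟩ := mem_reversal.1 hx
    have := α_le hy
    omega

lemma reversal_involutive (k : ℕ) : Function.Involutive (reversal k) := by
  refine fun X => ext_mem fun x => ?_
  rw [mem_reversal, α_reversal, β_reversal]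
  constructor
  · rintro ⟨y, hy, h⟩
    obtain ⟨z, hz, h'⟩ := mem_reversal.1 hy
    have : x = z := by omega
    exact this ▸ hz
  · intro hx
    have := le_β hx
    exact ⟨X.α + X.β - x, mem_reversal.2 ⟨x, hx, by omega⟩, by omega⟩

/-- The reversal map as an automorphism. -/
def reversalEquiv (k : ℕ) :
    PowerSemigroup (discreteInterval k) ≃+ PowerSemigroup (discreteInterval k) where
  toEquiv := (reversal_involutive k).toPerm
  map_add' X Y := by
    change reversal k (X + Y) = reversal k X + reversal k Y
    refine ext_mem fun z => ?_
    simp only [mem_reversal, mem_add, α_add, β_add]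
    constructor
    · rintro ⟨_, ⟨x, hx, y, hy, rfl⟩, h⟩
      have := le_β hx
      have := le_β hy
      have := α_le hx
      have := α_le hy
      exact ⟨X.α + X.β - x, ⟨x, hx, by omega⟩, Y.α + Y.β - y, ⟨y, hy, by omega⟩, by omega⟩
    · rintro ⟨x, ⟨a, ha, h⟩, y, ⟨b, hb, h'⟩, rfl⟩
      exact ⟨a + b, ⟨a, ha, b, hb, rfl⟩, by omega⟩

/-! ### Singletons and cancellativity. -/

/-- The one-element set `{a}`. -/
def single (a : ℕ) (h : k ≤ a) : PowerSemigroup (discreteInterval k) :=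
  ⟨{a}, Finset.singleton_nonempty a, fun _ hx => Finset.mem_singleton.1 hx ▸ h⟩

lemma mem_single {a x : ℕ} {h : k ≤ a} : x ∈ (single a h).1 ↔ x = a := Finset.mem_singleton

lemma mem_add_single {X : PowerSemigroup (discreteInterval k)} {a z : ℕ} {h : k ≤ a} :
    z ∈ (X + single a h).1 ↔ ∃ x ∈ X.1, x + a = z := by
  simp [mem_add, mem_single]

lemma single_add_single {a b : ℕ} (ha : k ≤ a) (hb : k ≤ b) (hab : k ≤ a + b) :
    single a ha + single b hb = single (a + b) hab :=
  ext_mem fun x => by rw [mem_add_single, mem_single]; simp [mem_single, eq_comm]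

lemma single_inj {a b : ℕ} {ha : k ≤ a} {hb : k ≤ b} : single a ha = single b hb ↔ a = b := by
  constructor
  · intro h
    have : a ∈ (single b hb).1 := h ▸ mem_single.2 rfl
    exact mem_single.1 this
  · rintro rfl; rfl

lemma add_single_injective {a : ℕ} (h : k ≤ a) :
    Function.Injective fun X : PowerSemigroup (discreteInterval k) => X + single a h := by
  intro X Y hXY
  refine ext_mem fun x => ?_
  have : x + a ∈ (X + single a h).1 ↔ x + a ∈ (Y + single a h).1 := by
    rw [show X + single a h = Y + single a h from hXY]
  simpa [mem_add_single] using this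

/-- The cancellative elements of the power semigroup are the one-element sets. -/
lemma exists_eq_single {X : PowerSemigroup (discreteInterval k)}
    (hX : ∀ Y Z, Y + X = Z + X → Y = Z) : ∃ a, ∃ h : k ≤ a, X = single a h := by
  by_contra! hne
  have hex : ∀ x, ∃ y ∈ X.1, y ≠ x := by
    intro x
    by_contra! hall
    have hx : X.α = x := hall _ X.α_mem
    exact hne x (hx ▸ le_of_mem X.α_mem) (ext_mem fun y => by
      rw [mem_single]
      exact ⟨hall y, fun h => by rw [h, ← hx]; exact X.α_mem⟩)
  let d := X.β
  have hd : 0 < d := by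
    obtain ⟨y, hy, hy0⟩ := hex 0
    have := le_β hy
    omega
  -- An interval and the same interval without its midpoint `k + d`. If `X` has two elements, a sum
  -- `(k + d) + x` is also `(k + d + x - x') + x'` with `x' ≠ x`, so adding `X` hides the hole.
  let Y : PowerSemigroup (discreteInterval k) :=
    ⟨Finset.Icc k (k + 2 * d), ⟨k, by simp⟩, fun x hx => (Finset.mem_Icc.1 hx).1⟩
  let Z : PowerSemigroup (discreteInterval k) :=
    ⟨(Finset.Icc k (k + 2 * d)).erase (k + d), ⟨k, by simp; omega⟩,
      fun x hx => (Finset.mem_Icc.1 (Finset.mem_of_mem_erase hx)).1⟩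
  have hY : ∀ x, x ∈ Y.1 ↔ k ≤ x ∧ x ≤ k + 2 * d := fun x => Finset.mem_Icc
  have hZ : ∀ x, x ∈ Z.1 ↔ x ≠ k + d ∧ k ≤ x ∧ x ≤ k + 2 * d := fun x => by
    simp [Z]
  have hYZ : Y = Z := by
    refine hX Y Z (ext_mem fun z => ?_)
    simp only [mem_add, hY, hZ]
    constructor
    · rintro ⟨y, hy, x, hx, rfl⟩
      by_cases hyd : y = k + d
      · obtain ⟨x', hx', hxx⟩ := hex x
        have h1 : x ≤ d := le_β hx
        have h2 : x' ≤ d := le_β hx'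
        exact ⟨k + d + x - x', by omega, x', hx', by omega⟩
      · exact ⟨y, ⟨hyd, hy⟩, x, hx, rfl⟩
    · rintro ⟨y, ⟨-, hy⟩, x, hx, rfl⟩
      exact ⟨y, hy, x, hx, rfl⟩
  have h1 : k + d ∈ Y.1 := (hY _).2 (by omega)
  rw [hYZ] at h1
  exact ((hZ _).1 h1).1 rfl

/-! ### Automorphisms fix every singleton. -/

section Automorphisms

variable (f : PowerSemigroup (discreteInterval k) ≃+ PowerSemigroup (discreteInterval k))

lemma exists_map_single {a : ℕ} (h : k ≤ a) : ∃ b, ∃ h' : k ≤ b, f (single a h) = single b h' := by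
  refine exists_eq_single fun Y Z hYZ => ?_
  rw [← f.apply_symm_apply Y, ← f.apply_symm_apply Z, ← map_add, ← map_add,
    f.injective.eq_iff] at hYZ
  exact f.symm.injective (add_single_injective h hYZ)

/-- The number `b` with `f {a} = {b}`. -/
noncomputable def singleMap (a : ℕ) : ℕ :=
  if h : k ≤ a then (exists_map_single f h).choose else 0

lemma le_singleMap {a : ℕ} (h : k ≤ a) : k ≤ singleMap f a := by
  rw [singleMap, dif_pos h]
  exact (exists_map_single f h).choose_spec.choose

lemma map_single_eq {a : ℕ} (h : k ≤ a) :
    f (single a h) = single (singleMap f a) (le_singleMap f h) := by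
  obtain ⟨h', h''⟩ := (exists_map_single f h).choose_spec
  rw [h'', single_inj, singleMap, dif_pos h]

lemma singleMap_add {a b : ℕ} (ha : k ≤ a) (hb : k ≤ b) :
    singleMap f (a + b) = singleMap f a + singleMap f b := by
  have h := map_single_eq f (show k ≤ a + b by omega)
  rw [← single_add_single ha hb, map_add, map_single_eq, map_single_eq,
    single_add_single _ _ (le_add_right (le_singleMap f ha)), single_inj] at h
  exact h.symm

lemma singleMap_mul {a : ℕ} (ha : k ≤ a) (n : ℕ) :
    singleMap f ((n + 1) * a) = (n + 1) * singleMap f a := by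
  induction n with
  | zero => simp
  | succ n ih =>
    rw [add_mul, one_mul, singleMap_add f (by nlinarith) ha, ih]
    ring

/-- Both sides are the value at `(k + 1) * a`, seen as a multiple of `a` and of `k + 1`. -/
lemma succ_mul_singleMap {a : ℕ} (ha : k ≤ a) :
    (k + 1) * singleMap f a = a * singleMap f (k + 1) := by
  cases a with
  | zero =>
    have h := singleMap_add f ha ha
    simp only [add_zero] at h
    have : singleMap f 0 = 0 := by omega
    simp [this]
  | succ n => rw [← singleMap_mul f ha, mul_comm, singleMap_mul f (by omega)]

lemma singleMap_symm {a : ℕ} (ha : k ≤ a) : singleMap f.symm (singleMap f a) = a := by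
  have h := map_single_eq f.symm (le_singleMap f ha)
  rw [← map_single_eq f ha, f.symm_apply_apply, single_inj] at h
  exact h.symm

/-- Taking `a = k` above, `k + 1` divides `k * singleMap f (k + 1)` and is coprime to `k`. -/
lemma succ_le_singleMap : k + 1 ≤ singleMap f (k + 1) := by
  have h := succ_mul_singleMap f (le_refl k)
  have hd : k + 1 ∣ singleMap f (k + 1) :=
    (Nat.coprime_self_add_left.2 (Nat.coprime_one_left k)).dvd_of_dvd_mul_left ⟨_, h.symm⟩
  refine Nat.le_of_dvd (Nat.pos_of_ne_zero fun h0 => ?_) hd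
  have h1 := succ_mul_singleMap f.symm (le_singleMap f (show k ≤ k + 1 by omega))
  rw [singleMap_symm f (by omega), h0] at h1
  simp at h1

lemma singleMap_eq {a : ℕ} (ha : k ≤ a) : singleMap f a = a := by
  have h1 := succ_le_singleMap f
  have h2 := succ_le_singleMap f.symm
  have h3 := succ_mul_singleMap f.symm (le_singleMap f (show k ≤ k + 1 by omega))
  rw [singleMap_symm f (by omega)] at h3
  -- The values of `f` and `f.symm` at `k + 1` are both at least `k + 1` and have product `(k + 1) ^
  -- 2`.
  have h4 : singleMap f (k + 1) = k + 1 := by nlinarith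
  have h5 := succ_mul_singleMap f ha
  rw [h4, mul_comm a] at h5
  exact Nat.eq_of_mul_eq_mul_left (by omega) h5

lemma map_single {a : ℕ} (ha : k ≤ a) : f (single a ha) = single a ha := by
  rw [map_single_eq, single_inj, singleMap_eq f ha]

/-! ### Translation to and from the reduced monoid. -/

/-- The translate `A + k` of a finite set `A` of natural numbers containing `0`. -/
def ofReduced (k : ℕ) (A : reducedPower) : PowerSemigroup (discreteInterval k) :=
  ⟨A.1.image (· + k), ⟨_, Finset.mem_image_of_mem _ A.2⟩, fun x hx => by
    obtain ⟨y, -, rfl⟩ := Finset.mem_image.1 hx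
    exact Nat.le_add_left k y⟩

lemma mem_ofReduced {A : reducedPower} {z : ℕ} : z ∈ (ofReduced k A).1 ↔ ∃ x ∈ A.1, x + k = z :=
  Finset.mem_image

lemma ofReduced_injective : Function.Injective (ofReduced k) := by
  intro A B h
  refine reducedPower.ext' fun x => ?_
  have : x + k ∈ (ofReduced k A).1 ↔ x + k ∈ (ofReduced k B).1 := by rw [h]
  simpa [mem_ofReduced] using this

lemma α_ofReduced (A : reducedPower) : (ofReduced k A).α = k :=
  α_eq (mem_ofReduced.2 ⟨0, A.2, zero_add k⟩) fun _ hx => le_of_mem hx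

/-- The translate `X - α(X)`, which contains `0`. -/
def toReduced {S : AddSubsemigroup ℕ} (X : PowerSemigroup S) : reducedPower :=
  ⟨X.1.image (· - X.α), Finset.mem_image.2 ⟨_, X.α_mem, Nat.sub_self _⟩⟩

lemma mem_toReduced {S : AddSubsemigroup ℕ} {X : PowerSemigroup S} {z : ℕ} :
    z ∈ (toReduced X).1 ↔ z + X.α ∈ X.1 := by
  refine Finset.mem_image.trans ⟨?_, fun h => ⟨_, h, by simp⟩⟩
  rintro ⟨x, hx, rfl⟩
  rwa [Nat.sub_add_cancel (α_le hx)]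

/-- Expresses normalisation of the minimum through addition of singletons only, so that
automorphisms respect it. -/
lemma ofReduced_toReduced_add (X : PowerSemigroup (discreteInterval k)) :
    ofReduced k (toReduced X) + single X.α (le_of_mem X.α_mem) = X + single k le_rfl := by
  refine ext_mem fun z => ?_
  simp only [mem_add_single, mem_ofReduced, mem_toReduced]
  constructor
  · rintro ⟨_, ⟨x, hx, rfl⟩, rfl⟩
    exact ⟨_, hx, by omega⟩
  · rintro ⟨x, hx, rfl⟩
    have := α_le hx
    exact ⟨_, ⟨x - X.α, by rwa [Nat.sub_add_cancel this], rfl⟩, by omega⟩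

lemma ofReduced_toReduced {X : PowerSemigroup (discreteInterval k)} (h : X.α = k) :
    ofReduced k (toReduced X) = X := by
  have h' := ofReduced_toReduced_add X
  simp only [h] at h'
  exact add_single_injective le_rfl h'

/-- Translation by `k` is additive only up to the cancellable summand `{k}`. -/
lemma ofReduced_add (A B : reducedPower) :
    ofReduced k (A + B) + single k le_rfl = ofReduced k A + ofReduced k B := by
  refine ext_mem fun z => ?_
  rw [mem_add_single]
  simp only [mem_add, mem_ofReduced, reducedPower.mem_add]
  constructor
  · rintro ⟨_, ⟨_, ⟨x, hx, y, hy, rfl⟩, rfl⟩, rfl⟩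
    exact ⟨_, ⟨x, hx, rfl⟩, _, ⟨y, hy, rfl⟩, by omega⟩
  · rintro ⟨_, ⟨x, hx, rfl⟩, _, ⟨y, hy, rfl⟩, rfl⟩
    exact ⟨_, ⟨_, ⟨x, hx, y, hy, rfl⟩, rfl⟩, by omega⟩

lemma map_ofReduced_toReduced_add (X : PowerSemigroup (discreteInterval k)) :
    f (ofReduced k (toReduced X)) + single X.α (le_of_mem X.α_mem) = f X + single k le_rfl := by
  have h := congrArg f (ofReduced_toReduced_add X)
  rwa [map_add, map_add, map_single, map_single] at h

lemma α_single {a : ℕ} (h : k ≤ a) : (single a h).α = a :=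
  α_eq (mem_single.2 rfl) fun _ hx => (mem_single.1 hx).ge

/-- Compare minima in the preceding translation identity: every set in the semigroup has minimum at
least `k`. -/
lemma α_le_α_map (X : PowerSemigroup (discreteInterval k)) : X.α ≤ (f X).α := by
  have h := congrArg α (map_ofReduced_toReduced_add f X)
  rw [α_add, α_add, α_single, α_single] at h
  have := le_of_mem (f (ofReduced k (toReduced X))).α_mem
  omega

lemma α_map (X : PowerSemigroup (discreteInterval k)) : (f X).α = X.α :=
  le_antisymm (by simpa using α_le_α_map f.symm (f X)) (α_le_α_map f X)

lemma ofReduced_toReduced_map (A : reducedPower) :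
    ofReduced k (toReduced (f (ofReduced k A))) = f (ofReduced k A) :=
  ofReduced_toReduced ((α_map f _).trans (α_ofReduced A))

/-- The automorphism of the reduced power monoid induced by an automorphism of the
power semigroup. -/
def inducedEquiv : reducedPower ≃+ reducedPower where
  toFun A := toReduced (f (ofReduced k A))
  invFun A := toReduced (f.symm (ofReduced k A))
  left_inv A := ofReduced_injective (k := k) <| by
    rw [ofReduced_toReduced_map, ofReduced_toReduced_map, f.symm_apply_apply]
  right_inv A := ofReduced_injective (k := k) <| by
    rw [ofReduced_toReduced_map, ofReduced_toReduced_map, f.apply_symm_apply]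
  map_add' A B := by
    refine ofReduced_injective (k := k) (add_single_injective (le_refl k) ?_)
    change ofReduced k _ + single k _ = ofReduced k _ + single k _
    rw [ofReduced_add, ofReduced_toReduced_map, ofReduced_toReduced_map, ofReduced_toReduced_map,
      ← map_add, ← ofReduced_add, map_add, map_single]

lemma ofReduced_inducedEquiv (A : reducedPower) :
    ofReduced k (inducedEquiv f A) = f (ofReduced k A) := ofReduced_toReduced_map f A

lemma top_toReduced (X : PowerSemigroup (discreteInterval k)) :
    reducedPower.top (toReduced X) + X.α = X.β := by
  have h := le_β X.α_mem
  rw [reducedPower.top_eq (n := X.β - X.α), Nat.sub_add_cancel h]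
  · rw [mem_toReduced, Nat.sub_add_cancel h]
    exact X.β_mem
  · intro x hx
    have := le_β (mem_toReduced.1 hx)
    omega

lemma toReduced_reversal (X : PowerSemigroup (discreteInterval k)) :
    toReduced (reversal k X) = reducedPower.reflect (toReduced X) := by
  refine reducedPower.ext' fun z => ?_
  have h := top_toReduced X
  rw [mem_toReduced, α_reversal, mem_reversal, reducedPower.mem_reflect]
  constructor
  · rintro ⟨x, hx, hz⟩
    have := α_le hx
    refine ⟨x - X.α, mem_toReduced.2 ?_, by omega⟩
    rwa [Nat.sub_add_cancel this]
  · rintro ⟨x, hx, hz⟩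
    exact ⟨_, mem_toReduced.1 hx, by omega⟩

/-- The only automorphisms of the power semigroup of `[k, ∞)` are the identity and the
reversal map. -/
theorem automorphism_classification : (∀ X, f X = X) ∨ ∀ X, f X = reversal k X := by
  rcases reducedPower.automorphism_classification (inducedEquiv f) with h | h
  · refine Or.inl fun X => add_single_injective (le_refl k) ?_
    change f X + _ = X + _
    rw [← map_ofReduced_toReduced_add, ← ofReduced_inducedEquiv, h, ofReduced_toReduced_add]
  · refine Or.inr fun X => add_single_injective (le_refl k) ?_
    change f X + _ = reversal k X + _
    rw [← map_ofReduced_toReduced_add, ← ofReduced_inducedEquiv, h, ← toReduced_reversal,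
      ← ofReduced_toReduced_add]
    congr 1
    rw [single_inj, α_reversal]

end Automorphisms

lemma reversal_ne_id (k : ℕ) : reversal k ≠ id := by
  intro h
  -- The witness is a translate of `{0, 2, 3}`, whose mirror image contains `1`.
  have h' := toReduced_reversal (ofReduced k (reducedPower.punctured 1 3))
  have hr : toReduced (ofReduced k (reducedPower.punctured 1 3)) = reducedPower.punctured 1 3 :=
    ofReduced_injective (ofReduced_toReduced (α_ofReduced _))
  rw [h, id, hr] at h'
  have h1 : 1 ∈ (reducedPower.punctured 1 3).1 := by
    rw [h', reducedPower.mem_reflect, reducedPower.top_punctured (by norm_num)]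
    exact ⟨2, reducedPower.mem_punctured.2 (by norm_num), rfl⟩
  rw [reducedPower.mem_punctured] at h1
  omega

end PowerSemigroup

theorem theorem3p8 (k : ℕ) :
    (∃ s : PowerSemigroup (discreteInterval k) ≃+ PowerSemigroup (discreteInterval k),
      ∀ X, s X = reversal k X) ∧
    Function.Involutive (reversal k) ∧
    reversal k ≠ id ∧
    ∀ f : PowerSemigroup (discreteInterval k) ≃+ PowerSemigroup (discreteInterval k),
      (∀ X, f X = X) ∨ (∀ X, f X = reversal k X) :=
  ⟨⟨PowerSemigroup.reversalEquiv k, fun _ => rfl⟩, PowerSemigroup.reversal_involutive k,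
    PowerSemigroup.reversal_ne_id k, PowerSemigroup.automorphism_classification⟩
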